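/- All graphs are finite and simple. For a real number $\alpha\ge 0$ let $\Theta(G,\alpha)$ be the largest eigenvalue of $M_\alpha(G)=A(G)+\alpha D(G)$, where $A(G)$ is the adjacency matrix and $D(G)$ the diagonal degree matrix of $G$. A connected graph with $m$ vertices is $c$-cyclic if it has $m+c-1$ edges. Let $t,c\ge 0$ be integers. A $t$-cone $c$-cyclic graph is a join $K_t\vee H$ of the complete graph $K_t$ ($K_0$ being the null graph) with a connected $c$-cyclic graph $H$ on at least two vertices; for a non-increasing sequence $\pi$, let $\Gamma(\pi,t;c)$ be the class of all $t$-cone $c$-cyclic graphs with degree sequence $\pi$. An internal path of $H$ is a path $Q=u_1u_2\cdots u_{k+1}$ $(k\ge 1)$ in $H$, whose ends $u_1,u_{k+1}$ may coincide (in which case $Q$ is a cycle through $u_1$), such that $d_H(u_1)\ge 3$, $d_H(u_{k+1})\ge 3$ and $d_H(u_i)=2$ for $2\le i\le k$. **Theorem 3.10.** Let $G_\pi=K_t\vee H$, with $H$ a $c$-cyclic graph of minimum degree $\delta(H)=1$, be $\Theta_\alpha$-maximal in $\Gamma(\pi,t;c)$, that is, $G_\pi\in\Gamma(\pi,t;c)$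 and $\Theta(G',\alpha)\le\Theta(G_\pi,\alpha)$ for all $G'\in\Gamma(\pi,t;c)$. Let $Q=u_1u_2\cdots u_{k+1}$ $(k\ge 1)$ be an internal path of $H$. (i) If $u_1=u_{k+1}$, then $k=3$. (ii) If $u_1\ne u_{k+1}$, then $k\le 2$, and $u_1u_3\in E(H)$ when $k=2$. -/

import Mathlib

namespace ConeGraph

/-- The join `G ∨ H`: the disjoint union of `G` and `H`, together with all edges between a vertex
of `G` and a vertex of `H`. -/
def join {V W : Type*} (G : SimpleGraph V) (H : SimpleGraph W) : SimpleGraph (V ⊕ W) :=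
  (G ⊕g H) ⊔ completeBipartiteGraph V W

/-- `K_t ∨ H`, where `K_t` is the complete graph on `t` vertices (the null graph if `t = 0`). -/
def cone {V : Type*} (t : ℕ) (H : SimpleGraph V) : SimpleGraph (Fin t ⊕ V) :=
  join (⊤ : SimpleGraph (Fin t)) H

/-- A connected simple graph with `n` vertices and `m` edges is `c`-cyclic if `m = n + c - 1`. -/
def IsCyclicGraph {V : Type*} (c : ℕ) (H : SimpleGraph V) : Prop :=
  H.Connected ∧ H.edgeSet.ncard + 1 = Nat.card V + c

/-- A `t`-cone `c`-cyclic graph on `n` vertices, `t ≤ n - 2`: a graph of the form `K_t ∨ H`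
(up to isomorphism), where `H` is a `c`-cyclic graph on `m = n - t ≥ 2` vertices. -/
def IsConeCyclic {W : Type*} (t c : ℕ) (G : SimpleGraph W) : Prop :=
  ∃ (m : ℕ) (H : SimpleGraph (Fin m)),
    2 ≤ m ∧ IsCyclicGraph c H ∧ Nonempty (G ≃g cone t H)

open scoped Classical in
/-- The degree sequence of `G`: the list of its vertex degrees in non-increasing order. -/
noncomputable def degreeSequence {W : Type*} [Fintype W] (G : SimpleGraph W) : List ℕ :=
  (Finset.univ.val.map fun w : W => G.degree w).sort (fun a b => b ≤ a)

/-- The class `Γ(π, t; c)` of `t`-cone `c`-cyclic graphs with degree sequence `π`. All its members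
have the same number of vertices, so they are taken on one fixed vertex set `W`. -/
def Gam (W : Type*) [Fintype W] (π : List ℕ) (t c : ℕ) : Set (SimpleGraph W) :=
  {G | IsConeCyclic t c G ∧ degreeSequence G = π}

open scoped Classical in
/-- The general matrix `M_α(G) = A(G) + α D(G)`. -/
noncomputable def genMatrix {W : Type*} [Fintype W] (α : ℝ) (G : SimpleGraph W) :
    Matrix W W ℝ :=
  G.adjMatrix ℝ + α • G.degMatrix ℝ

open scoped Classical in
/-- The general spectral radius `Θ(G, α)`: the maximal eigenvalue of `M_α(G)`. As `M_α(G)` is a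
real symmetric matrix, its set of eigenvalues is finite, and non-empty if `G` has a vertex, so
that the supremum is a maximum. -/
noncomputable def theta {W : Type*} [Fintype W] (G : SimpleGraph W) (α : ℝ) : ℝ :=
  sSup {μ : ℝ | Module.End.HasEigenvalue (Matrix.toLin' (genMatrix α G)) μ}

/-- `G` is a `Θ_α`-maximal graph of the class `𝒢`. -/
def IsThetaMaximal {W : Type*} [Fintype W] (α : ℝ) (𝒢 : Set (SimpleGraph W))
    (G : SimpleGraph W) : Prop :=
  G ∈ 𝒢 ∧ ∀ G' ∈ 𝒢, theta G' α ≤ theta G α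

/-- `Q = u₁ u₂ ⋯ u_{k+1}`, `k ≥ 1`, is an internal path of `H`: a path between distinct vertices
or, if its ends agree, a cycle through its end, such that both ends have degree at least three in
`H` and all inner vertices have degree two in `H`. -/
def IsInternalPath {V : Type*} {H : SimpleGraph V} [H.LocallyFinite] {u v : V}
    (Q : H.Walk u v) : Prop :=
  ((u ≠ v ∧ Q.IsPath) ∨ ∃ h : v = u, (Q.copy rfl h).IsCycle) ∧
    3 ≤ H.degree u ∧ 3 ≤ H.degree v ∧
    ∀ i : ℕ, 0 < i → i < Q.length → H.degree (Q.getVert i) = 2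

end ConeGraph

/-! Let `f` be the restriction to `H` of the Perron vector of `K_t ∨ H`. Replacing `H` by a
connected graph with the same degrees up to a permutation of the vertices stays in the class, so by
Rayleigh it cannot increase the quadratic form at `f`. If the form is unchanged, the vector is still
an eigenvector for the same eigenvalue, so the change of the matrix annihilates `f`. A change that
does not lower the form is therefore refuted by one nonzero entry. This is `IsExtremal`, after which
`t`, `c` and the degree sequence play no role.

Two changes are used. Shifting `deg u - deg v` edges from `u` to `v` exchanges the two degrees and
forces `f v < f u` (`IsExtremal.lt_of_shift`). Hence a vertex of degree two lies below an adjacent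
vertex of degree at least three, and a pendant vertex lies below every vertex of degree two.
Transplanting a vertex `w` of degree two, whose neighbours are not adjacent and have entries at
least `f w`, onto an edge `zz'` shows that `f z < f w` implies `f z' < f w`
(`IsExtremal.lt_of_transplant`).

Suppose that no inner vertex of the internal path has equal or adjacent path neighbours, and let `w`
be an inner vertex with the least entry. The pendant vertex has `f p < f w`, and this inequality
spreads along every walk, up to `w` itself: a contradiction. So some inner vertex lies in a
triangle. In a path of length at least three the chord of that triangle meets a second inner vertex,
whose degree two leaves only a cycle of length three. -/

namespace ConeGraph

open Matrix

/-! ### The general matrix as a linear function of the adjacency matrix -/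

open scoped Classical in
/-- The linear map sending the adjacency matrix of a graph to its general matrix. -/
noncomputable def addRowSums {W : Type*} [Fintype W] (α : ℝ) (P : Matrix W W ℝ) : Matrix W W ℝ :=
  P + α • diagonal (P *ᵥ 1)

open scoped Classical in
/-- The real adjacency matrix of a graph, with classical decidability. -/
noncomputable def adj {W : Type*} (G : SimpleGraph W) : Matrix W W ℝ := G.adjMatrix ℝ

open scoped Classical in
lemma adj_apply {W : Type*} (G : SimpleGraph W) (a b : W) :
    adj G a b = if G.Adj a b then 1 else 0 := rfl

open scoped Classical in
lemma adj_mulVec_one {W : Type*} [Fintype W] (G : SimpleGraph W) (w : W) :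
    (adj G *ᵥ 1) w = (G.degree w : ℝ) := by
  unfold adj
  rw [SimpleGraph.adjMatrix_mulVec_apply]
  simp

open scoped Classical in
lemma genMatrix_eq {W : Type*} [Fintype W] (α : ℝ) (G : SimpleGraph W) :
    genMatrix α G = addRowSums α (adj G) := by
  have h : adj G *ᵥ 1 = fun w => (G.degree w : ℝ) := funext (adj_mulVec_one G)
  rw [addRowSums, h]
  rfl

lemma addRowSums_add {W : Type*} [Fintype W] (α : ℝ) (P R : Matrix W W ℝ) :
    addRowSums α (P + R) = addRowSums α P + addRowSums α R := by
  classical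
  simp only [addRowSums, add_mulVec]
  have : diagonal (P *ᵥ 1 + R *ᵥ 1) = diagonal (P *ᵥ 1) + diagonal (R *ᵥ 1) := by
    rw [diagonal_add]; rfl
  ext i j
  have h := congrFun (congrFun this i) j
  simp only [Matrix.add_apply, Matrix.smul_apply, smul_eq_mul] at h ⊢
  simp only [diagonal_apply] at h ⊢
  rw [h]
  ring

lemma addRowSums_mulVec {W : Type*} [Fintype W] (α : ℝ) (P : Matrix W W ℝ) (f : W → ℝ) (w : W) :
    (addRowSums α P *ᵥ f) w = (P *ᵥ f) w + α * ((P *ᵥ 1) w * f w) := by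
  classical
  simp only [addRowSums, add_mulVec, smul_mulVec, Pi.add_apply, Pi.smul_apply, smul_eq_mul]
  congr 2
  convert mulVec_diagonal (P *ᵥ 1) f w

lemma genMatrix_isHermitian {W : Type*} [Fintype W] (α : ℝ) (G : SimpleGraph W) :
    (genMatrix α G).IsHermitian := by
  classical
  unfold genMatrix
  refine IsHermitian.add ?_ (IsHermitian.ext fun i j => ?_)
  · rw [IsHermitian, conjTranspose_eq_transpose_of_trivial, SimpleGraph.transpose_adjMatrix]
  · by_cases h : i = j
    · subst h; simp
    · simp [SimpleGraph.degMatrix, diagonal_apply_ne _ h, diagonal_apply_ne _ (Ne.symm h)]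

/-! ### Rayleigh quotients and the Perron vector -/

open scoped Classical in
lemma finite_eigenvalues {W : Type*} [Fintype W] (M : Matrix W W ℝ) :
    {μ : ℝ | Module.End.HasEigenvalue (Matrix.toLin' M) μ}.Finite :=
  Module.End.finite_hasEigenvalue _

-- An eigenvalue `μ` of the difference gives the eigenvalue `theta G α - μ` of the general matrix,
-- which is at most the supremum; so `μ ≥ 0`.
open scoped Classical in
lemma posSemidef_theta_sub {W : Type*} [Fintype W] (α : ℝ) (G : SimpleGraph W) :
    (theta G α • (1 : Matrix W W ℝ) - genMatrix α G).PosSemidef := by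
  have hM := genMatrix_isHermitian α G
  have hN : (theta G α • (1 : Matrix W W ℝ) - genMatrix α G).IsHermitian := by
    refine IsHermitian.sub ?_ hM
    rw [IsHermitian, conjTranspose_smul]; simp
  rw [hN.posSemidef_iff_eigenvalues_nonneg]
  intro i
  have h1 := hN.mulVec_eigenvectorBasis i
  have hne : (⇑(hN.eigenvectorBasis i) : W → ℝ) ≠ 0 := by
    intro h
    exact hN.eigenvectorBasis.orthonormal.ne_zero i (by ext j; exact congrFun h j)
  have h2 : Module.End.HasEigenvalue (Matrix.toLin' (genMatrix α G))
      (theta G α - hN.eigenvalues i) := by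
    refine Module.End.hasEigenvalue_of_hasEigenvector
      (x := (⇑(hN.eigenvectorBasis i) : W → ℝ)) ⟨?_, hne⟩
    rw [Module.End.mem_eigenspace_iff, toLin'_apply, sub_smul, ← h1, sub_mulVec, smul_mulVec,
      one_mulVec]
    abel
  have h3 : theta G α - hN.eigenvalues i ≤ theta G α :=
    le_csSup (finite_eigenvalues _).bddAbove h2
  simpa using h3

lemma dotProduct_genMatrix_le {W : Type*} [Fintype W] (α : ℝ) (G : SimpleGraph W) (x : W → ℝ) :
    x ⬝ᵥ (genMatrix α G *ᵥ x) ≤ theta G α * (x ⬝ᵥ x) := by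
  classical
  have h := (posSemidef_theta_sub α G).dotProduct_mulVec_nonneg x
  simp [sub_mulVec, smul_mulVec, dotProduct_sub] at h
  exact h

/-- A positive semidefinite form vanishes only on the kernel of its matrix, so equality in the
Rayleigh bound makes `x` an eigenvector. -/
lemma genMatrix_mulVec_of_eq {W : Type*} [Fintype W] (α : ℝ) (G : SimpleGraph W) (x : W → ℝ)
    (hx : x ⬝ᵥ (genMatrix α G *ᵥ x) = theta G α * (x ⬝ᵥ x)) :
    genMatrix α G *ᵥ x = theta G α • x := by
  classical
  have h := ((posSemidef_theta_sub α G).dotProduct_mulVec_zero_iff x).1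
  simp only [star_trivial, sub_mulVec, smul_mulVec, one_mulVec, dotProduct_sub, dotProduct_smul,
    smul_eq_mul, sub_eq_zero] at h
  exact (h hx.symm).symm

open scoped Classical in
lemma hasEigenvalue_theta {W : Type*} [Fintype W] [Nonempty W] (α : ℝ) (G : SimpleGraph W) :
    Module.End.HasEigenvalue (Matrix.toLin' (genMatrix α G)) (theta G α) := by
  refine Set.Nonempty.csSup_mem ?_ (finite_eigenvalues (genMatrix α G))
  have hM := genMatrix_isHermitian α G
  let i : W := Classical.arbitrary W
  refine ⟨hM.eigenvalues i, Module.End.hasEigenvalue_of_hasEigenvector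
      (x := (⇑(hM.eigenvectorBasis i) : W → ℝ)) ⟨?_, ?_⟩⟩
  · rw [Module.End.mem_eigenspace_iff, toLin'_apply, hM.mulVec_eigenvectorBasis i]
  · intro h
    exact hM.eigenvectorBasis.orthonormal.ne_zero i (by ext j; exact congrFun h j)

/-- A connected graph has a positive eigenvector belonging to its general spectral radius. -/
lemma exists_perron {W : Type*} [Fintype W] (α : ℝ) (hα : 0 ≤ α) (G : SimpleGraph W)
    (hG : G.Connected) :
    ∃ x : W → ℝ, (∀ w, 0 < x w) ∧ genMatrix α G *ᵥ x = theta G α • x := by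
  classical
  have := hG.nonempty
  obtain ⟨y, hy⟩ := (hasEigenvalue_theta α G).exists_hasEigenvector
  have hy0 : y ≠ 0 := hy.2
  have hyM : genMatrix α G *ᵥ y = theta G α • y := by
    have := hy.apply_eq_smul
    rwa [toLin'_apply] at this
  set x : W → ℝ := fun w => |y w| with hx
  have hx0 : ∀ w, 0 ≤ x w := fun w => abs_nonneg _
  have hxx : x ⬝ᵥ x = y ⬝ᵥ y := by
    simp [dotProduct, hx]
  have hpos : ∀ a b, 0 ≤ genMatrix α G a b := by
    intro a b
    simp only [genMatrix, SimpleGraph.degMatrix, Matrix.add_apply, Matrix.smul_apply,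
      SimpleGraph.adjMatrix_apply, diagonal_apply, smul_eq_mul]
    split_ifs <;> positivity
  -- The matrix has nonnegative entries, so passing to absolute values does not decrease the form
  -- while the norm is kept.
  have hxM : genMatrix α G *ᵥ x = theta G α • x := by
    refine genMatrix_mulVec_of_eq α G x (le_antisymm (dotProduct_genMatrix_le α G x) ?_)
    have : theta G α * (x ⬝ᵥ x) = y ⬝ᵥ (genMatrix α G *ᵥ y) := by
      rw [hyM, hxx, dotProduct_smul, smul_eq_mul]
    rw [this]
    simp only [dotProduct, mulVec, Finset.mul_sum]
    refine Finset.sum_le_sum fun a _ => Finset.sum_le_sum fun b _ => ?_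
    calc y a * (genMatrix α G a b * y b) = genMatrix α G a b * (y a * y b) := by ring
      _ ≤ genMatrix α G a b * (x a * x b) :=
          mul_le_mul_of_nonneg_left (by rw [hx, ← abs_mul]; exact le_abs_self _) (hpos a b)
      _ = _ := by ring
  refine ⟨x, ?_, hxM⟩
  -- At a zero `a` of `x` the diagonal term drops out, and the eigenvalue equation says that
  -- nonnegative numbers, the entries at the neighbours of `a`, sum to zero.
  have hstep : ∀ a b, G.Adj a b → x a = 0 → x b = 0 := by
    intro a b hab ha
    have h1 := congrFun hxM a
    rw [genMatrix_eq, addRowSums_mulVec] at h1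
    simp only [ha, Pi.smul_apply, smul_eq_mul, mul_zero, add_zero] at h1
    have h2 := (Finset.sum_eq_zero_iff_of_nonneg (fun v _ => mul_nonneg
      (show 0 ≤ adj G a v by rw [adj_apply]; split_ifs <;> norm_num) (hx0 v))).1 h1 b (Finset.mem_univ b)
    simpa [adj_apply, hab] using h2
  by_contra hcon
  push Not at hcon
  obtain ⟨w, hw⟩ := hcon
  have hw0 : x w = 0 := le_antisymm hw (hx0 w)
  have hall : ∀ v, x v = 0 := by
    intro v
    obtain ⟨p⟩ := hG.preconnected w v
    induction p with
    | nil => exact hw0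
    | cons h p ih => exact ih (hstep _ _ h hw0).le (hstep _ _ h hw0)
  exact hy0 (funext fun v => abs_eq_zero.1 (hall v))

/-- A connected graph that arises from a `Θ_α`-maximal one within its class cannot increase the
quadratic form at the Perron vector, and if it preserves it, then it preserves the eigenvector. -/
lemma IsThetaMaximal.dotProduct_le {W : Type*} [Fintype W] {α : ℝ} {𝒢 : Set (SimpleGraph W)}
    {G G' : SimpleGraph W} (hG : IsThetaMaximal α 𝒢 G) (hG' : G' ∈ 𝒢) {x : W → ℝ}
    (hx : genMatrix α G *ᵥ x = theta G α • x) :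
    x ⬝ᵥ (genMatrix α G' *ᵥ x) ≤ x ⬝ᵥ (genMatrix α G *ᵥ x) ∧
      (x ⬝ᵥ (genMatrix α G' *ᵥ x) = x ⬝ᵥ (genMatrix α G *ᵥ x) →
        genMatrix α G' *ᵥ x = genMatrix α G *ᵥ x) := by
  have h1 := dotProduct_genMatrix_le α G' x
  have hxx : 0 ≤ x ⬝ᵥ x := Finset.sum_nonneg fun i _ => mul_self_nonneg (x i)
  have h2 : theta G' α * (x ⬝ᵥ x) ≤ theta G α * (x ⬝ᵥ x) :=
    mul_le_mul_of_nonneg_right (hG.2 G' hG') hxx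
  have h3 : x ⬝ᵥ (genMatrix α G *ᵥ x) = theta G α * (x ⬝ᵥ x) := by
    rw [hx, dotProduct_smul, smul_eq_mul]
  refine ⟨by linarith, fun h => ?_⟩
  have h4 : theta G' α * (x ⬝ᵥ x) = theta G α * (x ⬝ᵥ x) := by linarith
  rw [genMatrix_mulVec_of_eq α G' x (by linarith), hx]
  rcases hxx.eq_or_lt with h0 | h0
  · have : x = 0 := by
      have := h0.symm
      rwa [dotProduct_self_eq_zero] at this
    simp [this]
  · rw [mul_right_cancel₀ h0.ne' h4]

/-! ### From cones to their bases -/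

lemma adj_cone {V : Type*} [Fintype V] (t : ℕ) (H : SimpleGraph V) :
    adj (cone t H) = fromBlocks (adj ⊤) (of fun _ _ => 1) (of fun _ _ => 1) (adj H) := by
  ext (i | v) (j | w)
  · simp [adj_apply, cone, join]
  · simp [adj_apply, cone, join]
  · simp [adj_apply, cone, join]
  · have h : (cone t H).Adj (Sum.inr v) (Sum.inr w) ↔ H.Adj v w := by simp [cone, join]
    rw [fromBlocks_apply₂₂, adj_apply, adj_apply]
    split_ifs <;> tauto

lemma cone_mulVec_one_inl {V : Type*} [Fintype V] (t : ℕ) (H H' : SimpleGraph V) (i : Fin t) :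
    (adj (cone t H) *ᵥ 1) (Sum.inl i) = (adj (cone t H') *ᵥ 1) (Sum.inl i) := by
  simp [adj_cone, mulVec, dotProduct]

lemma cone_mulVec_one_inr {V : Type*} [Fintype V] (t : ℕ) (H : SimpleGraph V) (v : V) :
    (adj (cone t H) *ᵥ 1) (Sum.inr v) = t + (adj H *ᵥ 1) v := by
  simp [adj_cone, mulVec, dotProduct]

lemma cone_connected {V : Type*} (t : ℕ) (H : SimpleGraph V) (hH : H.Connected) :
    (cone t H).Connected := by
  have := hH.nonempty
  let v₀ : V := Classical.arbitrary V
  have key : ∀ x, (cone t H).Reachable (Sum.inr v₀) x := by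
    rintro (i | v)
    · exact SimpleGraph.Adj.reachable (by simp [cone, join])
    · let φ : H →g cone t H := ⟨Sum.inr, fun {a b} h => by simpa [cone, join] using h⟩
      exact (hH.preconnected v₀ v).map φ
  exact ⟨fun x y => (key x).symm.trans (key y)⟩

lemma cone_sub_cone {V : Type*} [Fintype V] (t : ℕ) (H H' : SimpleGraph V) :
    adj (cone t H') - adj (cone t H) = fromBlocks 0 0 0 (adj H' - adj H) := by
  rw [adj_cone, adj_cone]
  ext (i | v) (j | w) <;> simp

/-- Both cones have the same edges at `K_t`, and the `t` these add to each degree in the base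
cancels; only the change in the base remains. -/
lemma cone_sub_mulVec {V : Type*} [Fintype V] (α : ℝ) (t : ℕ) (H H' : SimpleGraph V)
    (x : Fin t ⊕ V → ℝ) :
    genMatrix α (cone t H') *ᵥ x - genMatrix α (cone t H) *ᵥ x =
      Sum.elim (fun _ => (0 : ℝ)) (addRowSums α (adj H' - adj H) *ᵥ (x ∘ Sum.inr)) := by
  have h : genMatrix α (cone t H') =
      addRowSums α (fromBlocks 0 0 0 (adj H' - adj H)) + genMatrix α (cone t H) := by
    rw [genMatrix_eq, genMatrix_eq, ← addRowSums_add, ← cone_sub_cone, sub_add_cancel]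
  rw [h, add_mulVec, add_sub_cancel_right]
  funext w
  rw [addRowSums_mulVec]
  rcases w with i | v
  · simp [mulVec, dotProduct]
  · rw [Sum.elim_inr, addRowSums_mulVec]
    simp [mulVec, dotProduct]

/-- `f` is positive, and no connected graph with the degrees of `H` (up to a permutation of the
vertices) has a larger quadratic form at `f`; those with the same quadratic form at `f` act on `f`
in the same way. -/
def IsExtremal {V : Type*} [Fintype V] (α : ℝ) (H : SimpleGraph V) (f : V → ℝ) : Prop :=
  (∀ v, 0 < f v) ∧ ∀ H' : SimpleGraph V, H'.Connected →
    (∃ σ : V ≃ V, ∀ v, (adj H' *ᵥ 1) (σ v) = (adj H *ᵥ 1) v) →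
      f ⬝ᵥ (addRowSums α (adj H' - adj H) *ᵥ f) ≤ 0 ∧
        (f ⬝ᵥ (addRowSums α (adj H' - adj H) *ᵥ f) = 0 →
          addRowSums α (adj H' - adj H) *ᵥ f = 0)

open scoped Classical in
lemma ncard_edgeSet {V : Type*} [Fintype V] (H : SimpleGraph V) :
    ((2 * H.edgeSet.ncard : ℕ) : ℝ) = ∑ v, (adj H *ᵥ 1) v := by
  have h := H.sum_degrees_eq_twice_card_edges
  have h2 : H.edgeSet.ncard = H.edgeFinset.card := by
    rw [← SimpleGraph.coe_edgeFinset, Set.ncard_coe_finset]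
  rw [h2, ← h]
  push_cast
  exact Finset.sum_congr rfl fun v _ => (adj_mulVec_one H v).symm

/-- A graph isomorphism of bases extends to the cones. -/
def coneIso {V W : Type*} (t : ℕ) {H : SimpleGraph V} {K : SimpleGraph W} (e : H ≃g K) :
    cone t H ≃g cone t K where
  toEquiv := Equiv.sumCongr (Equiv.refl _) e.toEquiv
  map_rel_iff' := by
    rintro (i | v) (j | w) <;> simp [cone, join, e.map_adj_iff]

open scoped Classical in
lemma degreeSequence_eq {W : Type*} [Fintype W] {G G' : SimpleGraph W} (σ : W ≃ W)
    (h : ∀ w, (adj G' *ᵥ 1) (σ w) = (adj G *ᵥ 1) w) : degreeSequence G' = degreeSequence G := by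
  have hd : ∀ w, G'.degree (σ w) = G.degree w := by
    intro w
    have := h w
    rw [adj_mulVec_one, adj_mulVec_one] at this
    exact_mod_cast this
  unfold degreeSequence
  congr 1
  have h1 : (Finset.univ.val.map fun w => G'.degree (σ w)) =
      Finset.univ.val.map fun w => G'.degree w := by
    refine (Multiset.map_map (fun w => G'.degree w) σ _).symm.trans ?_
    congr 1
    exact congrArg Finset.val (Finset.map_univ_equiv σ)
  rw [← h1]
  simp only [hd]

/-- The degree sum determines the number of edges, so a connected graph with permuted degrees is
again `c`-cyclic. -/
lemma cone_mem_Gam {V : Type*} [Fintype V] {t c : ℕ} {π : List ℕ} {H H' : SimpleGraph V}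
    (hV : 2 ≤ Nat.card V) (hH : IsCyclicGraph c H) (hG : cone t H ∈ Gam (Fin t ⊕ V) π t c)
    (hc : H'.Connected) (σ : V ≃ V) (hσ : ∀ v, (adj H' *ᵥ 1) (σ v) = (adj H *ᵥ 1) v) :
    cone t H' ∈ Gam (Fin t ⊕ V) π t c := by
  have hcard : H'.edgeSet.ncard = H.edgeSet.ncard := by
    have h1 : ((2 * H'.edgeSet.ncard : ℕ) : ℝ) = (2 * H.edgeSet.ncard : ℕ) := by
      rw [ncard_edgeSet, ncard_edgeSet, ← Equiv.sum_comp σ]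
      exact Finset.sum_congr rfl fun v _ => hσ v
    have h2 : 2 * H'.edgeSet.ncard = 2 * H.edgeSet.ncard := by exact_mod_cast h1
    omega
  refine ⟨⟨Nat.card V, H'.map (Finite.equivFin V).toEmbedding, hV, ⟨?_, ?_⟩, ?_⟩, ?_⟩
  · exact (SimpleGraph.Iso.connected_iff (SimpleGraph.Iso.map (Finite.equivFin V) H')).1 hc
  · have h : (H'.map (Finite.equivFin V).toEmbedding).edgeSet.ncard = H'.edgeSet.ncard :=
      Nat.card_congr (SimpleGraph.Iso.map (Finite.equivFin V) H').mapEdgeSet.symm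
    rw [h, hcard, hH.2]
    simp
  · exact ⟨coneIso t (SimpleGraph.Iso.map (Finite.equivFin V) H')⟩
  · rw [← hG.2]
    refine degreeSequence_eq (Equiv.sumCongr (Equiv.refl _) σ) ?_
    rintro (i | v)
    · exact cone_mulVec_one_inl t H' H i
    · simp [cone_mulVec_one_inr, hσ]

/-- The Perron vector of the cone, restricted to the base, is extremal: the two cones differ only
there. -/
lemma IsThetaMaximal.exists_isExtremal {V : Type*} [Fintype V] {α : ℝ} (hα : 0 ≤ α) {t c : ℕ}
    {π : List ℕ} {H : SimpleGraph V} (hV : 2 ≤ Nat.card V) (hH : IsCyclicGraph c H)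
    (hmax : IsThetaMaximal α (Gam (Fin t ⊕ V) π t c) (cone t H)) :
    ∃ f : V → ℝ, IsExtremal α H f := by
  obtain ⟨x, hx0, hx⟩ := exists_perron α hα _ (cone_connected t H hH.1)
  refine ⟨x ∘ Sum.inr, fun v => hx0 _, fun H' hc ⟨σ, hσ⟩ => ?_⟩
  obtain ⟨h1, h2⟩ := hmax.dotProduct_le (cone_mem_Gam hV hH hmax.1 hc σ hσ) hx
  have h3 := cone_sub_mulVec α t H H' x
  have h4 : x ⬝ᵥ (genMatrix α (cone t H') *ᵥ x) - x ⬝ᵥ (genMatrix α (cone t H) *ᵥ x) =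
      (x ∘ Sum.inr) ⬝ᵥ (addRowSums α (adj H' - adj H) *ᵥ (x ∘ Sum.inr)) := by
    rw [← dotProduct_sub, h3]
    simp [dotProduct]
  rw [← h4]
  refine ⟨by linarith, fun h => ?_⟩
  rw [h2 (by linarith), sub_self] at h3
  funext v
  exact (congrFun h3 (Sum.inr v)).symm

/-! ### Local edge changes: shifting and transplanting -/

open scoped Classical in
/-- The adjacency matrix of the edge `ab`. -/
noncomputable def edgeMatrix {V : Type*} (a b : V) : Matrix V V ℝ :=
  of fun x y => (if x = a then if y = b then 1 else 0 else 0) +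
    (if x = b then if y = a then 1 else 0 else 0)

open scoped Classical in
lemma edgeMatrix_mulVec {V : Type*} [Fintype V] (a b : V) (f : V → ℝ) (w : V) :
    (edgeMatrix a b *ᵥ f) w = (if w = a then f b else 0) + (if w = b then f a else 0) := by
  simp only [edgeMatrix, mulVec, dotProduct, of_apply, add_mul, Finset.sum_add_distrib]
  congr 1 <;> split_ifs <;> simp

lemma dotProduct_edgeMatrix {V : Type*} [Fintype V] (a b : V) (f : V → ℝ) :
    f ⬝ᵥ (edgeMatrix a b *ᵥ f) = 2 * (f a * f b) := by
  classical
  simp only [dotProduct, edgeMatrix_mulVec, mul_add, Finset.sum_add_distrib, mul_ite, mul_zero,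
    Finset.sum_ite_eq', Finset.mem_univ, if_true]
  ring

lemma adj_sup_edge {V : Type*} {H : SimpleGraph V} {a b : V} (hab : a ≠ b) (h : ¬ H.Adj a b) :
    adj (H ⊔ SimpleGraph.edge a b) = adj H + edgeMatrix a b := by
  classical
  ext x y
  have h' : ¬ H.Adj b a := fun h' => h h'.symm
  simp only [adj_apply, edgeMatrix, Matrix.add_apply, of_apply, SimpleGraph.sup_adj,
    SimpleGraph.edge_adj]
  by_cases h1 : x = a <;> by_cases h2 : y = b <;> by_cases h3 : x = b <;> by_cases h4 : y = a <;>
    simp_all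

lemma adj_deleteEdge {V : Type*} {H : SimpleGraph V} {a b : V} (h : H.Adj a b) :
    adj (H.deleteEdges {s(a, b)}) = adj H - edgeMatrix a b := by
  classical
  ext x y
  have h' : H.Adj b a := h.symm
  have hab : a ≠ b := h.ne
  simp only [adj_apply, edgeMatrix, Matrix.sub_apply, of_apply, SimpleGraph.deleteEdges_adj,
    Set.mem_singleton_iff, Sym2.eq_iff]
  by_cases h1 : x = a <;> by_cases h2 : y = b <;> by_cases h3 : x = b <;> by_cases h4 : y = a <;>
    simp_all

/-- The graph obtained by replacing the edges between `u` and `T` with edges between `v` and `T`. -/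
def shift {V : Type*} (H : SimpleGraph V) (u v : V) (T : Finset V) : SimpleGraph V :=
  SimpleGraph.fromRel fun x y =>
    (H.Adj x y ∧ ¬ (x = u ∧ y ∈ T) ∧ ¬ (y = u ∧ x ∈ T)) ∨ (x = v ∧ y ∈ T)

/-- The conditions on `T` exclude loops, double edges and removal of missing edges, so the change is
a signed sum of edge matrices. -/
lemma adj_shift {V : Type*} {H : SimpleGraph V} {u v : V} {T : Finset V} (huv : u ≠ v)
    (hT : ∀ t ∈ T, H.Adj u t ∧ ¬ H.Adj v t ∧ t ≠ v) :
    adj (shift H u v T) - adj H = ∑ t ∈ T, (edgeMatrix v t - edgeMatrix u t) := by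
  classical
  have hu : u ∉ T := fun h => (hT u h).1.ne rfl
  have hv : v ∉ T := fun h => (hT v h).2.2 rfl
  ext x y
  have hxy : H.Adj x y ↔ H.Adj y x := H.adj_comm x y
  have hirr : H.Adj x y → x ≠ y := fun h => h.ne
  have hsum : (∑ t ∈ T, (edgeMatrix v t - edgeMatrix u t)) x y =
      ((if x = v ∧ y ∈ T then 1 else 0) + (if y = v ∧ x ∈ T then 1 else 0)) -
      ((if x = u ∧ y ∈ T then 1 else 0) + (if y = u ∧ x ∈ T then 1 else 0) : ℝ) := by
    simp only [Matrix.sum_apply, Matrix.sub_apply, edgeMatrix, of_apply, Finset.sum_sub_distrib,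
      Finset.sum_add_distrib]
    congr 1 <;> congr 1
    · by_cases h : x = v <;> simp [h]
    · by_cases h : y = v <;> simp [h]
    · by_cases h : x = u <;> simp [h]
    · by_cases h : y = u <;> simp [h]
  rw [hsum]
  simp only [Matrix.sub_apply, adj_apply, shift, SimpleGraph.fromRel_adj]
  by_cases hx : x ∈ T <;> by_cases hy : y ∈ T <;>
  by_cases hxu : x = u <;> by_cases hyu : y = u <;> by_cases hxv : x = v <;>
    by_cases hyv : y = v <;> grind

/-- The part with `α` sees only the row sums, that is, the change of the degrees. -/
lemma dotProduct_addRowSums {V : Type*} [Fintype V] (α : ℝ) (P : Matrix V V ℝ) (f : V → ℝ) :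
    f ⬝ᵥ (addRowSums α P *ᵥ f) = f ⬝ᵥ (P *ᵥ f) + α * ∑ v, (P *ᵥ 1) v * f v ^ 2 := by
  simp only [dotProduct, addRowSums_mulVec, mul_add, Finset.sum_add_distrib, Finset.mul_sum]
  congr 1
  exact Finset.sum_congr rfl fun v _ => by ring

lemma connected_of_adj_reachable {V : Type*} {H K : SimpleGraph V} (hH : H.Connected)
    (h : ∀ x y, H.Adj x y → K.Reachable x y) : K.Connected := by
  have := hH.nonempty
  refine ⟨fun x y => ?_⟩
  obtain ⟨p⟩ := hH.preconnected x y
  induction p with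
  | nil => exact SimpleGraph.Reachable.refl _
  | cons hxy p ih => exact (h _ _ hxy).trans ih

/-- Suppressing the vertex `w`, with neighbours `a` and `b`, and subdividing the edge `zz'` by it. -/
lemma exists_transplant {V : Type*} {H : SimpleGraph V} {a b w z z' : V}
    (hw : ∀ y, H.Adj w y ↔ y = a ∨ y = b) (hab : a ≠ b) (hnab : ¬ H.Adj a b) (hza : z ≠ a)
    (hzb : z ≠ b) (hzw : z ≠ w) (hz : H.Adj z z') (hz'w : z' ≠ w) :
    ∃ K : SimpleGraph V, adj K - adj H = edgeMatrix a b + edgeMatrix w z + edgeMatrix w z' -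
      edgeMatrix w a - edgeMatrix w b - edgeMatrix z z' ∧
      K.Adj a b ∧ K.Adj w z ∧ K.Adj w z' ∧
      ∀ x y, H.Adj x y → x ≠ w → y ≠ w → ¬ ((x = z ∧ y = z') ∨ (x = z' ∧ y = z)) →
        K.Adj x y := by
  classical
  have hwa : H.Adj w a := (hw a).2 (Or.inl rfl)
  have hwb : H.Adj w b := (hw b).2 (Or.inr rfl)
  have hawne := hwa.ne
  have hbwne := hwb.ne
  have hzz' := hz.ne
  have hnwz : ¬ H.Adj w z := by rw [hw]; tauto
  -- All deletions precede the insertions because `z'` may be `a` or `b`; the edge between `w` and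
  -- `z'` is then removed and put back.
  let K₁ := H.deleteEdges {s(w, a)}
  let K₂ := K₁.deleteEdges {s(w, b)}
  let K₃ := K₂.deleteEdges {s(z, z')}
  let K₄ := K₃ ⊔ SimpleGraph.edge a b
  let K₅ := K₄ ⊔ SimpleGraph.edge w z
  let K := K₅ ⊔ SimpleGraph.edge w z'
  have e₁ : adj K₁ = adj H - edgeMatrix w a := adj_deleteEdge hwa
  have a₁ : ∀ x y, K₁.Adj x y ↔ H.Adj x y ∧ ¬ ((x = w ∧ y = a) ∨ (x = a ∧ y = w)) := by
    intro x y
    simp [K₁, SimpleGraph.deleteEdges_adj]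
  have e₂ : adj K₂ = adj K₁ - edgeMatrix w b := adj_deleteEdge (by rw [a₁]; tauto)
  have a₂ : ∀ x y, K₂.Adj x y ↔ K₁.Adj x y ∧ ¬ ((x = w ∧ y = b) ∨ (x = b ∧ y = w)) := by
    intro x y
    simp [K₂, SimpleGraph.deleteEdges_adj]
  have e₃ : adj K₃ = adj K₂ - edgeMatrix z z' := adj_deleteEdge (by rw [a₂, a₁]; tauto)
  have a₃ : ∀ x y, K₃.Adj x y ↔ K₂.Adj x y ∧ ¬ ((x = z ∧ y = z') ∨ (x = z' ∧ y = z)) := by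
    intro x y
    simp [K₃, SimpleGraph.deleteEdges_adj]
  have e₄ : adj K₄ = adj K₃ + edgeMatrix a b :=
    adj_sup_edge hab (by rw [a₃, a₂, a₁]; tauto)
  have a₄ : ∀ x y, K₄.Adj x y ↔ K₃.Adj x y ∨ ((x = a ∧ y = b) ∨ (x = b ∧ y = a)) := by
    intro x y
    rw [SimpleGraph.sup_adj, SimpleGraph.edge_adj]
    grind
  have e₅ : adj K₅ = adj K₄ + edgeMatrix w z :=
    adj_sup_edge hzw.symm (by rw [a₄, a₃, a₂, a₁]; tauto)
  have a₅ : ∀ x y, K₅.Adj x y ↔ K₄.Adj x y ∨ ((x = w ∧ y = z) ∨ (x = z ∧ y = w)) := by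
    intro x y
    rw [SimpleGraph.sup_adj, SimpleGraph.edge_adj]
    grind
  have e₆ : adj K = adj K₅ + edgeMatrix w z' :=
    adj_sup_edge hz'w.symm (by rw [a₅, a₄, a₃, a₂, a₁, hw]; grind)
  have a₆ : ∀ x y, K.Adj x y ↔ K₅.Adj x y ∨ ((x = w ∧ y = z') ∨ (x = z' ∧ y = w)) := by
    intro x y
    rw [SimpleGraph.sup_adj, SimpleGraph.edge_adj]
    grind
  have hP : adj K - adj H = edgeMatrix a b + edgeMatrix w z + edgeMatrix w z' -
      edgeMatrix w a - edgeMatrix w b - edgeMatrix z z' := by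
    rw [e₆, e₅, e₄, e₃, e₂, e₁]; abel
  refine ⟨K, hP, ?_, ?_, ?_, ?_⟩
  · rw [a₆, a₅, a₄]; exact Or.inl (Or.inl (Or.inr (Or.inl ⟨rfl, rfl⟩)))
  · rw [a₆, a₅]; exact Or.inl (Or.inr (Or.inl ⟨rfl, rfl⟩))
  · rw [a₆]; exact Or.inr (Or.inl ⟨rfl, rfl⟩)
  · intro x y hxy hx hy h
    rw [a₆, a₅, a₄, a₃, a₂, a₁]
    exact Or.inl (Or.inl (Or.inl ⟨⟨⟨hxy, by rintro (h | h); exacts [hx h.1, hy h.2]⟩,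
      by rintro (h | h); exacts [hx h.1, hy h.2]⟩, h⟩))

/-- Transplanting a vertex of degree two keeps a graph connected. -/
lemma connected_of_transplant {V : Type*} {H K : SimpleGraph V} {a b w z z' : V}
    (hH : H.Connected) (hw : ∀ y, H.Adj w y ↔ y = a ∨ y = b) (hzw : z ≠ w)
    (hKab : K.Adj a b) (hKz : K.Adj w z) (hKz' : K.Adj w z')
    (hK : ∀ x y, H.Adj x y → x ≠ w → y ≠ w → ¬ ((x = z ∧ y = z') ∨ (x = z' ∧ y = z)) →
      K.Adj x y) : K.Connected := by
  have hrzz' : K.Reachable z z' := hKz.symm.reachable.trans hKz'.reachable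
  have hother : ∀ x y, H.Adj x y → x ≠ w → y ≠ w → K.Reachable x y := by
    intro x y hxy hx hy
    by_cases h : (x = z ∧ y = z') ∨ (x = z' ∧ y = z)
    · rcases h with ⟨rfl, rfl⟩ | ⟨rfl, rfl⟩
      · exact hrzz'
      · exact hrzz'.symm
    · exact (hK x y hxy hx hy h).reachable
  have hza : K.Reachable z a := by
    obtain ⟨p⟩ := hH.preconnected z a
    -- A walk outside `w` can enter `w` only from `a` or `b`, and the new edge `ab` then leads to
    -- `a` directly.
    have key : ∀ {x : V} (p : H.Walk x a), x ≠ w → K.Reachable x a := by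
      intro x p
      induction h : p.length using Nat.strong_induction_on generalizing x with
      | _ n ih =>
        intro hx
        cases p with
        | nil => exact SimpleGraph.Reachable.refl _
        | @cons _ y _ hxy p =>
          by_cases hy : y = w
          · subst hy
            rcases (hw x).1 hxy.symm with rfl | rfl
            · exact SimpleGraph.Reachable.refl _
            · exact hKab.symm.reachable
          · exact (hother x y hxy hx hy).trans (ih p.length (by simp at h; omega) p rfl hy)
    exact key p hzw
  have hwa' : K.Reachable w a := hKz.reachable.trans hza
  have hww : ∀ y, H.Adj w y → K.Reachable w y := by
    intro y hy
    rcases (hw y).1 hy with rfl | rfl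
    · exact hwa'
    · exact hwa'.trans hKab.reachable
  refine connected_of_adj_reachable hH fun x y hxy => ?_
  by_cases hx : x = w
  · subst hx; exact hww y hxy
  by_cases hy : y = w
  · subst hy; exact (hww x hxy.symm).symm
  exact hother x y hxy hx hy

/-! ### Strict inequalities between entries of an extremal vector -/

section

variable {V : Type*} [Fintype V] {α : ℝ} {H : SimpleGraph V} {f : V → ℝ}

/-- If moving the `deg u - deg v` edges between `u` and `T` to `v` keeps the graph connected, then
`f v < f u` for every extremal `f`. -/
lemma IsExtremal.lt_of_shift (hf : IsExtremal α H f) (hα : 0 ≤ α) (hH : H.Connected)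
    {u v : V} (huv : u ≠ v) {T : Finset V} (hT0 : T.Nonempty)
    (hT : ∀ t ∈ T, H.Adj u t ∧ ¬ H.Adj v t ∧ t ≠ v)
    (hdeg : (adj H *ᵥ 1) u = (adj H *ᵥ 1) v + T.card)
    (hr : (H.deleteEdges {e | ∃ t ∈ T, e = s(u, t)}).Reachable u v) : f v < f u := by
  classical
  have hu : u ∉ T := fun h => (hT u h).1.ne rfl
  have hv : v ∉ T := fun h => (hT v h).2.2 rfl
  set K := shift H u v T with hK
  have hP := adj_shift huv hT
  rw [← hK] at hP
  have hmul : ∀ (g : V → ℝ) (x : V), ((adj K - adj H) *ᵥ g) x =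
      ((if x = v then ∑ t ∈ T, g t else 0) - (if x = u then ∑ t ∈ T, g t else 0)) +
        if x ∈ T then g v - g u else 0 := by
    intro g x
    rw [hP, Matrix.sum_mulVec, Finset.sum_apply]
    simp only [sub_mulVec, Pi.sub_apply, edgeMatrix_mulVec, Finset.sum_sub_distrib,
      Finset.sum_add_distrib]
    by_cases h1 : x = v <;> by_cases h2 : x = u <;> by_cases h3 : x ∈ T <;>
      simp_all
  have hdelta : ∀ x, ((adj K - adj H) *ᵥ 1) x =
      (if x = v then (T.card : ℝ) else 0) - (if x = u then (T.card : ℝ) else 0) := by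
    intro x
    rw [hmul]
    simp
  have hle : H.deleteEdges {e | ∃ t ∈ T, e = s(u, t)} ≤ K := by
    intro x y hxy
    rw [SimpleGraph.deleteEdges_adj] at hxy
    simp only [hK, shift, SimpleGraph.fromRel_adj]
    refine ⟨hxy.1.ne, Or.inl (Or.inl ⟨hxy.1, fun h => hxy.2 ⟨y, h.2, by rw [h.1]⟩, fun h =>
      hxy.2 ⟨x, h.2, by rw [h.1, Sym2.eq_swap]⟩⟩)⟩
  have hKuv : K.Reachable u v := hr.mono hle
  have hKv : ∀ t ∈ T, K.Adj v t := by
    intro t ht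
    simp only [hK, shift, SimpleGraph.fromRel_adj]
    exact ⟨(hT t ht).2.2.symm, Or.inl (Or.inr ⟨trivial, ht⟩)⟩
  have hKc : K.Connected := by
    refine connected_of_adj_reachable hH fun x y hxy => ?_
    by_cases h1 : x = u ∧ y ∈ T
    · rw [h1.1]
      exact hKuv.trans (hKv y h1.2).reachable
    by_cases h2 : y = u ∧ x ∈ T
    · rw [h2.1]
      exact (hKuv.trans (hKv x h2.2).reachable).symm
    · refine SimpleGraph.Adj.reachable ?_
      simp only [hK, shift, SimpleGraph.fromRel_adj]
      exact ⟨hxy.ne, Or.inl (Or.inl ⟨hxy, h1, h2⟩)⟩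
  -- Exactly `deg u - deg v` edges move, so `u` and `v` exchange their degrees and the others keep
  -- theirs.
  have hσ : ∀ x, (adj K *ᵥ 1) (Equiv.swap u v x) = (adj H *ᵥ 1) x := by
    have h1 : ∀ x, (adj K *ᵥ 1) x = (adj H *ᵥ 1) x +
        ((if x = v then (T.card : ℝ) else 0) - (if x = u then (T.card : ℝ) else 0)) := by
      intro x
      rw [← hdelta x, sub_mulVec, Pi.sub_apply]
      ring
    intro x
    rw [h1]
    by_cases hxu : x = u
    · subst hxu
      simp [huv.symm, hdeg]
    by_cases hxv : x = v
    · subst hxv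
      simp [huv, hdeg]
    · rw [Equiv.swap_apply_of_ne_of_ne hxu hxv]
      simp [hxu, hxv]
  obtain ⟨h1, h2⟩ := hf.2 K hKc ⟨Equiv.swap u v, hσ⟩
  by_contra hcon
  push Not at hcon
  have hsum : 0 < ∑ t ∈ T, f t := Finset.sum_pos (fun t _ => hf.1 t) hT0
  have hcard : (0 : ℝ) ≤ T.card := Nat.cast_nonneg _
  have hform : f ⬝ᵥ (addRowSums α (adj K - adj H) *ᵥ f) =
      2 * ((∑ t ∈ T, f t) * (f v - f u)) + α * (T.card * (f v ^ 2 - f u ^ 2)) := by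
    rw [dotProduct_addRowSums]
    simp only [dotProduct, hmul f, hdelta, mul_add, mul_sub, sub_mul, ite_mul, mul_ite, zero_mul,
      mul_zero, Finset.sum_add_distrib, Finset.sum_sub_distrib, Finset.sum_ite_eq',
      Finset.mem_univ, if_true, Finset.sum_ite_mem, Finset.univ_inter]
    rw [← Finset.sum_mul, ← Finset.sum_mul]
    ring
  have hsq : 0 ≤ f v ^ 2 - f u ^ 2 := by
    have := pow_le_pow_left₀ (hf.1 u).le hcon 2
    linarith
  have h0 : 0 ≤ f ⬝ᵥ (addRowSums α (adj K - adj H) *ᵥ f) := by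
    rw [hform]
    have : 0 ≤ f v - f u := by linarith
    positivity
  -- The form is unchanged, so this entry must vanish; but it is the positive sum of `f` over `T`
  -- plus `α * T.card * f v`.
  have h3 := congrFun (h2 (le_antisymm h1 h0)) v
  rw [addRowSums_mulVec, hmul, hdelta] at h3
  simp only [if_true, huv.symm, if_false, hv, Pi.zero_apply, sub_zero, add_zero] at h3
  have : 0 ≤ α * ((T.card : ℝ) * f v) := by
    have := (hf.1 v).le
    positivity
  linarith

/-- Let `w` have exactly the two neighbours `a` and `b`, not adjacent to each other, with
`f w ≤ f a` and `f w ≤ f b`. Suppressing `w` and subdividing an edge `zz'` by `w` instead shows that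
`f z < f w` implies `f z' < f w`. -/
lemma IsExtremal.lt_of_transplant (hf : IsExtremal α H f) (hH : H.Connected) {a b w z z' : V}
    (hw : ∀ y, H.Adj w y ↔ y = a ∨ y = b) (hab : a ≠ b) (hnab : ¬ H.Adj a b)
    (ha : f w ≤ f a) (hb : f w ≤ f b) (hz : H.Adj z z') (hz'w : z' ≠ w)
    (hlt : f z < f w) : f z' < f w := by
  classical
  have hza : z ≠ a := by rintro rfl; linarith
  have hzb : z ≠ b := by rintro rfl; linarith
  have hzw : z ≠ w := by rintro rfl; linarith
  have hzz' := hz.ne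
  obtain ⟨K, hP, hKab, hKz, hKz', hKo⟩ :=
    exists_transplant hw hab hnab hza hzb hzw hz hz'w
  have hKc := connected_of_transplant hH hw hzw hKab hKz hKz' hKo
  have hone : (adj K - adj H) *ᵥ 1 = 0 := by
    funext x
    rw [hP]
    simp only [add_mulVec, sub_mulVec, Pi.add_apply, Pi.sub_apply, edgeMatrix_mulVec, Pi.one_apply,
      Pi.zero_apply]
    ring
  obtain ⟨h1, h2⟩ := hf.2 K hKc ⟨Equiv.refl V, fun x => by
    have := congrFun hone x
    rw [sub_mulVec, Pi.sub_apply, Pi.zero_apply, sub_eq_zero] at this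
    simpa using this⟩
  have hform : f ⬝ᵥ (addRowSums α (adj K - adj H) *ᵥ f) =
      2 * ((f a - f w) * (f b - f w) - (f w - f z) * (f w - f z')) := by
    rw [dotProduct_addRowSums, hone, hP]
    simp only [add_mulVec, sub_mulVec, dotProduct_add, dotProduct_sub, dotProduct_edgeMatrix,
      Pi.zero_apply, zero_mul, Finset.sum_const_zero, mul_zero, add_zero]
    ring
  have hprod : 0 ≤ (f a - f w) * (f b - f w) :=
    mul_nonneg (by linarith) (by linarith)
  by_contra hcon
  push Not at hcon
  have hprod' : 0 ≤ (f w - f z) * (f z' - f w) := mul_nonneg (by linarith) (by linarith)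
  have h0 : f ⬝ᵥ (addRowSums α (adj K - adj H) *ᵥ f) = 0 := by
    refine le_antisymm h1 ?_
    rw [hform]
    linarith
  -- This entry should vanish, but it is `f w - f z > 0` plus nonnegative corrections in the cases
  -- `z' = a` and `z' = b`.
  have h3 := congrFun (h2 h0) z'
  rw [addRowSums_mulVec, hone, hP] at h3
  simp only [add_mulVec, sub_mulVec, Pi.add_apply, Pi.sub_apply, edgeMatrix_mulVec,
    Pi.zero_apply, zero_mul, mul_zero, add_zero, hz'w, hzz'.symm, if_true, if_false, zero_add] at h3
  have h4 : 0 ≤ (if z' = a then f b else 0) - (if z' = a then f w else 0) := by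
    split_ifs <;> linarith
  have h5 : 0 ≤ (if z' = b then f a else 0) - (if z' = b then f w else 0) := by
    split_ifs <;> linarith
  linarith

open scoped Classical in
lemma degree_of_pair {w a b : V} (hw : ∀ y, H.Adj w y ↔ y = a ∨ y = b) (hab : a ≠ b) :
    H.degree w = 2 := by
  rw [← SimpleGraph.card_neighborFinset_eq_degree, ← Finset.card_pair hab]
  congr 1
  ext y
  simp [hw]

open scoped Classical in
lemma degree_of_single {p q : V} (hp : ∀ y, H.Adj p y ↔ y = q) : H.degree p = 1 := by
  rw [← SimpleGraph.card_neighborFinset_eq_degree, Finset.card_eq_one]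
  exact ⟨q, by ext y; simp [hp]⟩

open scoped Classical in
/-- A vertex of degree two has a smaller entry than an adjacent vertex of degree at least three. -/
lemma IsExtremal.lt_of_adj (hf : IsExtremal α H f) (hα : 0 ≤ α) (hH : H.Connected)
    {u w b : V} (hw : ∀ y, H.Adj w y ↔ y = u ∨ y = b) (hub : u ≠ b) (hu : 3 ≤ H.degree u) :
    f w < f u := by
  have hwu : H.Adj w u := (hw u).2 (Or.inl rfl)
  -- Besides `w`, kept to join `u` to `w`, also `b` is excluded, as it is already a neighbour of
  -- `w`.
  have hcard : H.degree u - 2 ≤ (((H.neighborFinset u).erase w).erase b).card := by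
    have h1 := Finset.pred_card_le_card_erase (s := H.neighborFinset u) (a := w)
    have h2 := Finset.pred_card_le_card_erase (s := (H.neighborFinset u).erase w) (a := b)
    rw [SimpleGraph.card_neighborFinset_eq_degree] at h1
    omega
  obtain ⟨T, hTs, hTc⟩ := Finset.exists_subset_card_eq hcard
  have hT : ∀ t ∈ T, H.Adj u t ∧ t ≠ w ∧ t ≠ b := by
    intro t ht
    have := hTs ht
    simp only [Finset.mem_erase, SimpleGraph.mem_neighborFinset] at this
    tauto
  refine hf.lt_of_shift hα hH hwu.ne.symm (T := T) (Finset.card_pos.1 (by omega)) ?_ ?_ ?_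
  · intro t ht
    obtain ⟨h1, h2, h3⟩ := hT t ht
    exact ⟨h1, by rw [hw]; rintro (h | h); exacts [h1.ne h.symm, h3 h], h2⟩
  · rw [adj_mulVec_one, adj_mulVec_one, degree_of_pair hw hub, hTc, Nat.cast_sub (by omega)]
    ring
  · refine SimpleGraph.Adj.reachable ?_
    rw [SimpleGraph.deleteEdges_adj]
    refine ⟨hwu.symm, ?_⟩
    rintro ⟨t, ht, h⟩
    rw [Sym2.congr_right] at h
    exact (hT t ht).2.1 h.symm

open scoped Classical in
/-- A pendant vertex has a smaller entry than a vertex of degree two. -/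
lemma IsExtremal.lt_of_pendant (hf : IsExtremal α H f) (hα : 0 ≤ α) (hH : H.Connected)
    {p q w a b : V} (hw : ∀ y, H.Adj w y ↔ y = a ∨ y = b) (hab : a ≠ b)
    (hp : ∀ y, H.Adj p y ↔ y = q) : f p < f w := by
  have hwp : w ≠ p := by
    rintro rfl
    have := degree_of_pair hw hab
    have := degree_of_single hp
    omega
  -- The single edge `wd` is moved to `p`, while the other neighbour `c` must still lead from `w` to
  -- `p`.
  have key : ∀ c d, H.Adj w c → H.Adj w d → c ≠ d → d ≠ p → d ≠ q →
      (H.deleteEdges {s(w, d)}).Reachable c p → f p < f w := by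
    intro c d hc hd hcd hdp hdq hr
    refine hf.lt_of_shift hα hH hwp (T := {d}) (Finset.singleton_nonempty d) ?_ ?_ ?_
    · intro t ht
      rw [Finset.mem_singleton.1 ht, hp]
      exact ⟨hd, hdq, hdp⟩
    · rw [adj_mulVec_one, adj_mulVec_one, degree_of_pair hw hab, degree_of_single hp]
      norm_num
    · have : {e | ∃ t ∈ ({d} : Finset V), e = s(w, t)} = {s(w, d)} := by ext e; simp
      rw [this]
      refine (SimpleGraph.Adj.reachable ?_).trans hr
      rw [SimpleGraph.deleteEdges_adj, Set.mem_singleton_iff, Sym2.congr_right]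
      exact ⟨hc, hcd⟩
  have hsymm : ∀ c, H.Adj w c → ∃ d, H.Adj w d ∧ c ≠ d := by
    intro c hc
    rcases (hw c).1 hc with rfl | rfl
    · exact ⟨b, (hw b).2 (Or.inr rfl), hab⟩
    · exact ⟨a, (hw a).2 (Or.inl rfl), hab.symm⟩
  have hpq : H.Adj p q := (hp q).2 rfl
  by_cases h1 : H.Adj w p
  · obtain ⟨d, hd, hpd⟩ := hsymm p h1
    have hwq : w = q := (hp w).1 h1.symm
    exact key p d h1 hd hpd hpd.symm (hwq ▸ hd.ne.symm) (SimpleGraph.Reachable.refl _)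
  by_cases h2 : H.Adj w q
  · obtain ⟨d, hd, hqd⟩ := hsymm q h2
    refine key q d h2 hd hqd (fun h => h1 (h ▸ hd)) hqd.symm (SimpleGraph.Adj.reachable ?_)
    rw [SimpleGraph.deleteEdges_adj, Set.mem_singleton_iff, Sym2.eq_iff]
    refine ⟨hpq.symm, ?_⟩
    rintro (h | h)
    · exact h2.ne h.1.symm
    · exact hwp h.2.symm
  -- Take for `c` the first step of a path to `p`: the rest never returns to `w`, hence avoids `wd`.
  · obtain ⟨P, hP⟩ := (hH.preconnected w p).exists_isPath
    cases P with
    | nil => exact absurd rfl hwp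
    | @cons _ c _ hc P =>
      rw [SimpleGraph.Walk.cons_isPath_iff] at hP
      obtain ⟨d, hd, hcd⟩ := hsymm c hc
      refine key c d hc hd hcd (fun h => h1 (h ▸ hd)) (fun h => h2 (h ▸ hd)) ⟨P.toDeleteEdge _ ?_⟩
      exact fun h => hP.2 (P.fst_mem_support_of_mem_edges h)

/-! ### Internal paths: the inner vertex with the least entry -/

open scoped Classical in
lemma adj_iff_of_degree_two {w a b : V} (ha : H.Adj w a) (hb : H.Adj w b) (hab : a ≠ b)
    (hw : H.degree w = 2) (y : V) : H.Adj w y ↔ y = a ∨ y = b := by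
  have h : ({a, b} : Finset V) = H.neighborFinset w := by
    refine Finset.eq_of_subset_of_card_le ?_ ?_
    · intro x hx
      rcases Finset.mem_insert.1 hx with rfl | hx
      · simpa using ha
      · rw [Finset.mem_singleton.1 hx]; simpa using hb
    · rw [SimpleGraph.card_neighborFinset_eq_degree, hw, Finset.card_pair hab]
  rw [← SimpleGraph.mem_neighborFinset, ← h]
  simp

open scoped Classical in
/-- In a graph with an extremal vector and a pendant vertex, the neighbours of some inner vertex of
an internal path `g 0, …, g k` coincide or are adjacent. -/
lemma IsExtremal.exists_adj_of_internal (hf : IsExtremal α H f) (hα : 0 ≤ α) (hH : H.Connected)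
    {p : V} (hp : H.degree p = 1) (g : ℕ → V) {k : ℕ} (hk : 2 ≤ k)
    (hadj : ∀ i < k, H.Adj (g i) (g (i + 1)))
    (hdeg : ∀ i, 0 < i → i < k → H.degree (g i) = 2)
    (h0 : 3 ≤ H.degree (g 0)) (hk3 : 3 ≤ H.degree (g k)) :
    ∃ i, i + 2 ≤ k ∧ (g i = g (i + 2) ∨ H.Adj (g i) (g (i + 2))) := by
  by_contra! hcon
  have hN : ∀ i, i + 2 ≤ k → ∀ y, H.Adj (g (i + 1)) y ↔ y = g i ∨ y = g (i + 2) := fun i hi =>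
    adj_iff_of_degree_two (hadj i (by omega)).symm (hadj (i + 1) (by omega)) (hcon i hi).1
      (hdeg _ (by omega) (by omega))
  -- The inner vertices are `g (i + 1)` with `i < k - 1`. The end vertices need no minimality: their
  -- degree is at least three.
  obtain ⟨i, hi, hmin⟩ := Finset.exists_min_image (Finset.range (k - 1)) (fun i => f (g (i + 1)))
    ⟨0, by simp; omega⟩
  simp only [Finset.mem_range] at hi hmin
  have hi2 : i + 2 ≤ k := by omega
  have ha : f (g (i + 1)) ≤ f (g i) := by
    rcases i with _ | i
    · exact (hf.lt_of_adj hα hH (hN 0 hi2) (hcon 0 hi2).1 h0).le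
    · exact hmin i (by omega)
  have hb : f (g (i + 1)) ≤ f (g (i + 2)) := by
    by_cases h : i + 2 = k
    · refine (hf.lt_of_adj hα hH (fun y => ?_) (hcon i hi2).1.symm (h ▸ hk3)).le
      rw [hN i hi2, or_comm]
    · exact hmin (i + 1) (by omega)
  obtain ⟨q, hq⟩ := SimpleGraph.degree_eq_one_iff_existsUnique_adj.1 hp
  have hpq : ∀ y, H.Adj p y ↔ y = q := fun y => ⟨hq.2 y, fun h => h ▸ hq.1⟩
  have hpw := hf.lt_of_pendant hα hH (hN i hi2) (hcon i hi2).1 hpq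
  -- A walk cannot leave the set where `f` is below the minimum: each edge avoiding `w = g (i + 1)`
  -- is covered by a transplant, and no edge enters `w` from this set, since both neighbours of `w`
  -- have entries at least `f w`.
  have hall : ∀ {x y : V}, H.Walk x y → f x < f (g (i + 1)) → f y < f (g (i + 1)) := by
    intro x y W
    induction W with
    | nil => exact id
    | @cons x z _ hxz W ih =>
      intro hx
      refine ih ?_
      by_cases hz : z = g (i + 1)
      · subst hz
        rcases (hN i hi2 x).1 hxz.symm with rfl | rfl
        · exact absurd hx (not_lt.2 ha)
        · exact absurd hx (not_lt.2 hb)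
      · exact hf.lt_of_transplant hH (hN i hi2) (hcon i hi2).1 (hcon i hi2).2 ha hb hxz hz hx
  obtain ⟨W⟩ := hH.preconnected p (g (i + 1))
  exact lt_irrefl _ (hall W hpw)

end

/-- A cycle is injective on the indices `1, …, k` and on `0, …, k - 1`, so only the indices `0` and
`k` can share a vertex; a path has no repetition at all. -/
lemma IsInternalPath.eq_of_getVert_eq {V : Type*} {H : SimpleGraph V} [H.LocallyFinite]
    {u v : V} {Q : H.Walk u v} (hQ : IsInternalPath Q) {i j : ℕ} (hij : i < j)
    (hj : j ≤ Q.length) (h : Q.getVert i = Q.getVert j) : i = 0 ∧ j = Q.length ∧ u = v := by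
  rcases hQ.1 with ⟨-, hp⟩ | ⟨rfl, hc⟩
  · have := hp.getVert_injOn (show i ≤ Q.length by omega) hj h
    omega
  · rw [SimpleGraph.Walk.copy_rfl_rfl] at hc
    refine ⟨?_, ?_, rfl⟩
    · by_contra h0
      have := hc.getVert_injOn (show 1 ≤ i ∧ i ≤ Q.length by omega)
        (show 1 ≤ j ∧ j ≤ Q.length by omega) h
      omega
    · by_contra h0
      have := hc.getVert_injOn' (show i ≤ Q.length - 1 by omega)
        (show j ≤ Q.length - 1 by omega) h
      omega

end ConeGraph

open ConeGraph in
theorem theorem3p10 {V : Type*} [Fintype V] (α : ℝ) (hα : 0 ≤ α) (t c : ℕ) (π : List ℕ)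
    (H : SimpleGraph V) [DecidableRel H.Adj]
    (hH : ConeGraph.IsCyclicGraph c H)
    (hmax : ConeGraph.IsThetaMaximal α (ConeGraph.Gam (Fin t ⊕ V) π t c) (ConeGraph.cone t H))
    (hδ : H.minDegree = 1)
    (u v : V) (Q : H.Walk u v) (hQ : ConeGraph.IsInternalPath Q) :
    (u = v → Q.length = 3) ∧
      (u ≠ v → Q.length ≤ 2 ∧ (Q.length = 2 → H.Adj u v)) := by
  classical
  have := hH.1.nonempty
  obtain ⟨p, hp⟩ := H.exists_minimal_degree_vertex
  rw [hδ] at hp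
  have hV : 2 ≤ Nat.card V := by
    have := H.degree_lt_card_verts p
    rw [Nat.card_eq_fintype_card]
    omega
  obtain ⟨f, hf⟩ := hmax.exists_isExtremal hα hV hH
  have hdeg : ∀ w (I J : Fintype (H.neighborSet w)),
      @SimpleGraph.degree V H w I = @SimpleGraph.degree V H w J := fun w I J => by congr!
  have hadj : ∀ i < Q.length, H.Adj (Q.getVert i) (Q.getVert (i + 1)) := fun i hi =>
    Q.adj_getVert_succ hi
  have main : 2 ≤ Q.length → ∃ i, i + 2 ≤ Q.length ∧
      (Q.getVert i = Q.getVert (i + 2) ∨ H.Adj (Q.getVert i) (Q.getVert (i + 2))) := fun hk =>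
    hf.exists_adj_of_internal hα hH.1 (p := p) ((hdeg p _ _).trans hp.symm) Q.getVert hk hadj
      (fun i h1 h2 => (hdeg _ _ _).trans (hQ.2.2.2 i h1 h2))
      (by rw [Q.getVert_zero]; exact hQ.2.1.trans_eq (hdeg _ _ _))
      (by rw [Q.getVert_length]; exact hQ.2.2.1.trans_eq (hdeg _ _ _))
  have hinj := fun i j hij hj h => hQ.eq_of_getVert_eq (i := i) (j := j) hij hj h
  have hN : ∀ i, i + 2 ≤ Q.length → Q.getVert i ≠ Q.getVert (i + 2) →
      ∀ y, H.Adj (Q.getVert (i + 1)) y ↔ y = Q.getVert i ∨ y = Q.getVert (i + 2) :=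
    fun i hi hne => adj_iff_of_degree_two (hadj i (by omega)).symm (hadj (i + 1) (by omega)) hne
      ((hdeg _ _ _).trans (hQ.2.2.2 _ (by omega) (by omega)))
  -- As the length is at least three, one end of the chord is an inner vertex. Its two neighbours
  -- are its path neighbours, so the other end of the chord, two indices away, coincides with the
  -- path neighbour on the far side, three indices away.
  have hchord : ∀ i, i + 2 ≤ Q.length → 3 ≤ Q.length →
      H.Adj (Q.getVert i) (Q.getVert (i + 2)) → Q.length = 3 ∧ u = v := by
    intro i hi h3 h
    rcases i with _ | i
    · rcases (hN 1 (by omega) fun h => by have := hinj _ _ (by omega) (by omega) h; omega) _ |>.1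
        h.symm with h | h
      · have := hinj _ _ (by omega) (by omega) h
        omega
      · have := hinj _ _ (by omega) (by omega) h
        exact ⟨by omega, this.2.2⟩
    · rcases (hN i (by omega) fun h => by have := hinj _ _ (by omega) (by omega) h; omega) _ |>.1
        h with h | h
      · have := hinj _ _ (by omega) (by omega) h.symm
        exact ⟨by omega, this.2.2⟩
      · have := hinj _ _ (by omega) (by omega) h.symm
        omega
  constructor
  · intro huv
    have h3 : 3 ≤ Q.length := by
      rcases hQ.1 with ⟨hne, -⟩ | ⟨h, hc⟩
      · exact absurd huv hne
      · simpa using hc.three_le_length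
    obtain ⟨i, hi, h | h⟩ := main (by omega)
    · have := hinj _ _ (by omega) hi h
      omega
    · exact (hchord i hi h3 h).1
  · intro huv
    have hkey : ∀ i, i + 2 ≤ Q.length →
        (Q.getVert i = Q.getVert (i + 2) ∨ H.Adj (Q.getVert i) (Q.getVert (i + 2))) →
        Q.length = 2 ∧ H.Adj u v := by
      rintro i hi (h | h)
      · exact absurd (hinj _ _ (by omega) hi h).2.2 huv
      · by_cases h3 : 3 ≤ Q.length
        · exact absurd (hchord i hi h3 h).2 huv
        · have hi0 : i = 0 := by omega
          have hl : Q.length = 2 := by omega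
          subst hi0
          rw [Q.getVert_zero, zero_add, ← hl, Q.getVert_length] at h
          exact ⟨hl, h⟩
    by_cases hk : 2 ≤ Q.length
    · obtain ⟨i, hi, h⟩ := main hk
      obtain ⟨h2, h4⟩ := hkey i hi h
      exact ⟨h2.le, fun _ => h4⟩
    · exact ⟨by omega, fun h => by omega⟩
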